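/- Let $\mathscr{L}$ be a real Hilbert space and let $(\Omega,\mathcal{F},\mathbb{P})$ be a probability space whose measurable space $(\Omega,\mathcal{F})$ is standard Borel. Let $\Phi:\mathscr{L}\to L^2(\Omega,\mathbb{P})$ be a Gaussian field, i.e. a linear map such that $(\Phi(h))_{h\in\mathscr{L}}$ is a Gaussian process with $\mathbb{E}(\Phi(h))=0$ and $\mathbb{E}(\Phi(h)\Phi(k))=\langle h,k\rangle$ for all $h,k\in\mathscr{L}$. Assume that $\mathcal{F}$ is generated by $\{\Phi(h):h\in\mathscr{L}\}$ up to $\mathbb{P}$-null sets. Let $\mathscr{D}\subset L^2(\Omega,\mathbb{P})$ be the space of all $F=p(\Phi(h_1),\dots,\Phi(h_n))$ with $n\ge 0$, $h_1,\dots,h_n\in\mathscr{L}$ and $p\in\mathbb{R}[x_1,\dots,x_n]$, and let $T$ be the Malliavin derivative, the unbounded operator from $L^2(\Omega,\mathbb{P})$ to $L^2(\Omega,\mathbb{P})\otimes\mathscr{L}=L^2(\Omega\to\mathscr{L},\mathbb{P})$ with domain $\mathscr{D}$ and $$T\big(p(\Phi(h_1),\dots,\Phi(h_n))\big)=\sum_{j=1}^n\frac{\partial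 p}{\partial x_j}(\Phi(h_1),\dots,\Phi(h_n))\otimes h_j .$$ Let $\mathrm{Aut}(\Omega,\mathcal{F},\mathbb{P})$ be the set of maps $\alpha:\Omega\to\Omega$, defined and identified $\mathbb{P}$-almost everywhere, that are measurable, preserve $\mathbb{P}$, and for which there is $\Omega_0\in\mathcal{F}$ with $\mathbb{P}(\Omega_0)=1$, with $\alpha(\Omega_0)$ of full measure, and with $\{A\cap\Omega_0:A\in\mathcal{F}\}=\{\alpha^{-1}(B)\cap\Omega_0:B\in\mathcal{F}\}$. For $\alpha\in\mathrm{Aut}(\Omega,\mathcal{F},\mathbb{P})$ put $U_\alpha F=F\circ\alpha$ on $L^2(\Omega,\mathbb{P})$, and for a unitary $U$ on $\mathscr{L}$ let $U_\alpha\otimes U$ be the bounded operator $\psi\mapsto U\circ\psi\circ\alpha$ on $L^2(\Omega\to\mathscr{L},\mathbb{P})$, so that $(U_\alpha\otimes U)(F\otimes k)=U_\alpha F\otimes Uk$. Then $T$ is well defined on $\mathscr{D}$, and the following hold. (1) For every unitary operator $U$ on $\mathscr{L}$ there is a unique $\alpha\in\mathrm{Aut}(\Omega,\mathcal{F},\mathbb{P})$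 (unique up to equality $\mathbb{P}$-a.e.) such that $\Phi(Uk)=\Phi(k)\circ\alpha$, equivalently $\Phi(Uk)=U_\alpha(\Phi(k))$, for all $k\in\mathscr{L}$. (2) For $U$ and $\alpha$ as in (1), $TU_\alpha=(U_\alpha\otimes U)T$ as operators with domain $\mathscr{D}$: for $F\in L^2(\Omega,\mathbb{P})$ we have $U_\alpha F\in\mathscr{D}$ if and only if $F\in\mathscr{D}$, and then $T(U_\alpha F)=(U_\alpha\otimes U)(TF)$. -/

import Mathlib

open MeasureTheory ProbabilityTheory
open scoped ENNReal RealInnerProductSpace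

noncomputable section

namespace GaussianField

variable {Ω : Type*} [MeasurableSpace Ω] {L : Type*} [NormedAddCommGroup L]
  [InnerProductSpace ℝ L]

/-- A Gaussian field over the real Hilbert space `L`: a linear map `Φ : L → L²(Ω, ℙ)` such that
`(Φ h)_{h ∈ L}` is a centred Gaussian process whose covariance is the inner product of `L`. -/
structure IsGaussianField (P : Measure Ω) (Φ : L →ₗ[ℝ] Lp ℝ 2 P) : Prop where
  mean_zero : ∀ h : L, ∫ ω, Φ h ω ∂P = 0
  gaussian : IsGaussianProcess (fun (h : L) (ω : Ω) => Φ h ω) P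
  covariance : ∀ h k : L, ∫ ω, Φ h ω * Φ k ω ∂P = ⟪h, k⟫

/-- The σ-algebra generated by (representatives of) all the random variables `Φ h`. -/
abbrev fieldSigmaAlgebra {P : Measure Ω} (Φ : L →ₗ[ℝ] Lp ℝ 2 P) : MeasurableSpace Ω :=
  ⨆ h : L, MeasurableSpace.comap (fun ω => Φ h ω) (borel ℝ)

/-- The σ-algebra of `Ω` is, up to null sets, the one generated by the field. A different choice
of the representatives of the classes `Φ h` does not change this property. -/
def GeneratesSigmaAlgebra {P : Measure Ω} (Φ : L →ₗ[ℝ] Lp ℝ 2 P) : Prop :=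
  ∀ A : Set Ω, MeasurableSet A →
    ∃ B : Set Ω, MeasurableSet[fieldSigmaAlgebra Φ] B ∧ A =ᵐ[P] B

/-- An automorphism of the probability space `(Ω, ℱ, P)`, given by an everywhere defined measurable
representative `toFun`. On a measurable set `Ω₀` of full measure, with image of full measure, the
σ-algebra `ℱ` consists exactly of the preimages of members of `ℱ`; and `P` is preserved. Two
automorphisms are identified when they agree almost everywhere. -/
structure MeasureAut (P : Measure Ω) where
  toFun : Ω → Ω
  measurePreserving : MeasurePreserving toFun P P
  exists_conull : ∃ Ω₀ : Set Ω, MeasurableSet Ω₀ ∧ P Ω₀ᶜ = 0 ∧ P (toFun '' Ω₀)ᶜ = 0 ∧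
    ∀ A : Set Ω, MeasurableSet A →
      ∃ B : Set Ω, MeasurableSet B ∧ A ∩ Ω₀ = toFun ⁻¹' B ∩ Ω₀

/-- The operator `U_α F = F ∘ α` on `L²(Ω, P)`. -/
def MeasureAut.koopman {P : Measure Ω} (α : MeasureAut P) : Lp ℝ 2 P →ₗᵢ[ℝ] Lp ℝ 2 P :=
  Lp.compMeasurePreservingₗᵢ ℝ α.toFun α.measurePreserving

/-- The elementary tensor `F ⊗ k`, in the realization `L²(Ω, P) ⊗ L = L²(Ω → L, P)`, that is, the
class of `ω ↦ F ω • k`. -/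
def elemTensor {P : Measure Ω} (F : Lp ℝ 2 P) (k : L) : Lp L 2 P :=
  (ContinuousLinearMap.toSpanSingleton ℝ k).compLpL 2 P F

/-- The operator `U_α ⊗ U` on `L²(Ω, P) ⊗ L = L²(Ω → L, P)`: it maps `ψ` to `U ∘ ψ ∘ α`.
See `koopmanTensor_elemTensor` for its values on elementary tensors. -/
def MeasureAut.koopmanTensor {P : Measure Ω} (α : MeasureAut P) (U : L ≃ₗᵢ[ℝ] L) :
    Lp L 2 P →L[ℝ] Lp L 2 P :=
  ((U : L ≃L[ℝ] L) : L →L[ℝ] L).compLpL 2 P ∘L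
    (Lp.compMeasurePreservingₗᵢ ℝ α.toFun α.measurePreserving).toContinuousLinearMap

theorem elemTensor_ae {P : Measure Ω} (F : Lp ℝ 2 P) (k : L) :
    elemTensor F k =ᵐ[P] fun ω => F ω • k :=
  ContinuousLinearMap.coeFn_compLpL _ F

theorem MeasureAut.koopman_ae {P : Measure Ω} (α : MeasureAut P) (F : Lp ℝ 2 P) :
    α.koopman F =ᵐ[P] fun ω => F (α.toFun ω) :=
  Lp.coeFn_compMeasurePreserving F α.measurePreserving

theorem MeasureAut.koopmanTensor_ae {P : Measure Ω} (α : MeasureAut P) (U : L ≃ₗᵢ[ℝ] L)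
    (ψ : Lp L 2 P) : α.koopmanTensor U ψ =ᵐ[P] fun ω => U (ψ (α.toFun ω)) := by
  refine (ContinuousLinearMap.coeFn_compLpL _ _).trans ?_
  filter_upwards [Lp.coeFn_compMeasurePreserving ψ α.measurePreserving] with ω hω
  exact congrArg U hω

theorem MeasureAut.koopmanTensor_elemTensor {P : Measure Ω} (α : MeasureAut P) (U : L ≃ₗᵢ[ℝ] L)
    (F : Lp ℝ 2 P) (k : L) :
    α.koopmanTensor U (elemTensor F k) = elemTensor (α.koopman F) (U k) := by
  refine Lp.ext ?_
  filter_upwards [α.koopmanTensor_ae U (elemTensor F k), elemTensor_ae (α.koopman F) (U k),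
    α.koopman_ae F, α.measurePreserving.quasiMeasurePreserving.ae (elemTensor_ae F k)]
    with ω h1 h2 h3 h4
  rw [h1, h2, h3, h4, map_smul]

/-- The polynomial random variable `p(Φ(h₁), …, Φ(hₙ))`. -/
def polyField {P : Measure Ω} (Φ : L →ₗ[ℝ] Lp ℝ 2 P) {n : ℕ} (h : Fin n → L)
    (p : MvPolynomial (Fin n) ℝ) : Ω → ℝ :=
  fun ω => MvPolynomial.eval (fun i => Φ (h i) ω) p

/-- The vector valued random variable `∑ⱼ (∂p/∂xⱼ)(Φ(h₁), …, Φ(hₙ)) ⊗ hⱼ`. -/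
def polyGradient {P : Measure Ω} (Φ : L →ₗ[ℝ] Lp ℝ 2 P) {n : ℕ} (h : Fin n → L)
    (p : MvPolynomial (Fin n) ℝ) : Ω → L :=
  fun ω => ∑ j, MvPolynomial.eval (fun i => Φ (h i) ω) (MvPolynomial.pderiv j p) • h j

/-- The graph of the Malliavin derivative: the span in `L²(Ω, P) × L²(Ω → L, P)` of the pairs
`(p(Φ(h₁), …, Φ(hₙ)), ∑ⱼ (∂p/∂xⱼ)(Φ(h₁), …, Φ(hₙ)) ⊗ hⱼ)`. -/
def malliavinGraph {P : Measure Ω} (Φ : L →ₗ[ℝ] Lp ℝ 2 P) :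
    Submodule ℝ (Lp ℝ 2 P × Lp L 2 P) :=
  Submodule.span ℝ {FG | ∃ (n : ℕ) (h : Fin n → L) (p : MvPolynomial (Fin n) ℝ),
    FG.1 =ᵐ[P] polyField Φ h p ∧ FG.2 =ᵐ[P] polyGradient Φ h p}

/-- The Malliavin derivative `T : L²(Ω, P) → L²(Ω → L, P)`, as the unbounded operator with graph
`malliavinGraph Φ`; its domain is the space of polynomial random variables. -/
def malliavinDerivative {P : Measure Ω} (Φ : L →ₗ[ℝ] Lp ℝ 2 P) : Lp ℝ 2 P →ₗ.[ℝ] Lp L 2 P :=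
  (malliavinGraph Φ).toLinearPMap

end GaussianField

end

/-! Well-definedness of `T`: expand the `h i` in an orthonormal basis `e` of their span. The `Φ (e
j)` are independent standard Gaussians, so their joint law charges every open set, and a polynomial
in them vanishing almost surely is the zero polynomial. The chain rule `gradAt_bind₁` then kills the
gradient (`IsGaussianField.polyGradient_ae_eq_zero`).

Existence of `α`: `Φ` is isometric into a separable `L²`, so `L` has a dense sequence `h`. The
vector `X = (Φ (h n))` generates the σ-algebra modulo null sets, hence has a measurable left inverse
`Y` almost everywhere (`exists_measurable_ae_leftInverse`). Covariances determine centred Gaussian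
laws, so `X` and `X_U = (Φ (U (h n)))` have the same law; therefore `α = Y ∘ X_U` preserves `P` and
`X ∘ α = X_U` almost surely, and density extends this to all of `L`. The same construction for `U⁻¹`
inverts `α`. Uniqueness holds because `X` determines the point through `Y`.

Covariance of `T`: composition with `α` replaces each `h i` by `U (h i)` in both components of the
graph. -/

open MeasureTheory ProbabilityTheory
open scoped ENNReal RealInnerProductSpace

noncomputable section

namespace GaussianField

/-! ### Formal gradients of polynomials. -/

section PolynomialGradient

theorem eval_bind₁_apply {σ τ : Type*} (g : σ → MvPolynomial τ ℝ) (y : τ → ℝ) (p : MvPolynomial σ ℝ) :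
    MvPolynomial.eval y (MvPolynomial.bind₁ g p) =
      MvPolynomial.eval (fun i => MvPolynomial.eval y (g i)) p :=
  MvPolynomial.eval₂Hom_bind₁ (RingHom.id ℝ) y g p

variable {σ τ : Type*} [Fintype σ] [Fintype τ] {L : Type*} [AddCommGroup L] [Module ℝ L]

/-- The vector `∑ⱼ (∂p/∂xⱼ)(x) • hⱼ`. -/
def gradAt (x : σ → ℝ) (h : σ → L) (p : MvPolynomial σ ℝ) : L :=
  ∑ j, MvPolynomial.eval x (MvPolynomial.pderiv j p) • h j

theorem gradAt_C (x : σ → ℝ) (h : σ → L) (a : ℝ) : gradAt x h (MvPolynomial.C a) = 0 := by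
  simp [gradAt]

theorem gradAt_X (x : σ → ℝ) (h : σ → L) (i : σ) : gradAt x h (MvPolynomial.X i) = h i := by
  classical
  simp [gradAt, MvPolynomial.pderiv_X, Pi.single_apply, apply_ite, ite_smul]

theorem gradAt_add (x : σ → ℝ) (h : σ → L) (p q : MvPolynomial σ ℝ) :
    gradAt x h (p + q) = gradAt x h p + gradAt x h q := by
  simp [gradAt, add_smul, Finset.sum_add_distrib]

theorem gradAt_mul (x : σ → ℝ) (h : σ → L) (p q : MvPolynomial σ ℝ) :
    gradAt x h (p * q) =
      MvPolynomial.eval x q • gradAt x h p + MvPolynomial.eval x p • gradAt x h q := by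
  simp only [gradAt, MvPolynomial.pderiv_mul, map_add, map_mul, add_smul, Finset.sum_add_distrib,
    Finset.smul_sum, smul_smul]
  congr 1
  exact Finset.sum_congr rfl fun j _ => by rw [mul_comm]

/-- The chain rule for polynomial substitutions. -/
theorem gradAt_bind₁ (g : σ → MvPolynomial τ ℝ) (y : τ → ℝ) (e : τ → L) (p : MvPolynomial σ ℝ) :
    gradAt y e (MvPolynomial.bind₁ g p) =
      gradAt (fun i => MvPolynomial.eval y (g i)) (fun i => gradAt y e (g i)) p := by
  induction p using MvPolynomial.induction_on with
  | C a => simp [gradAt_C]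
  | add p q hp hq => rw [map_add, gradAt_add, gradAt_add, hp, hq]
  | mul_X p i hp =>
    rw [map_mul, gradAt_mul, gradAt_mul, hp, MvPolynomial.bind₁_X_right, eval_bind₁_apply,
      gradAt_X, MvPolynomial.eval_X]

theorem gradAt_linear (y : τ → ℝ) (e : τ → L) (a : τ → ℝ) :
    gradAt y e (∑ j, MvPolynomial.C (a j) * MvPolynomial.X j) = ∑ j, a j • e j := by
  classical
  simp [gradAt, MvPolynomial.pderiv_X, Pi.single_apply, apply_ite]

end PolynomialGradient

/-! ### Joint laws of the field. -/

section Law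

variable {Ω : Type*} [MeasurableSpace Ω] {L : Type*} [NormedAddCommGroup L]
  [InnerProductSpace ℝ L] {P : Measure Ω} {Φ : L →ₗ[ℝ] Lp ℝ 2 P}

theorem measurable_field (h : L) : Measurable (fun ω => Φ h ω) :=
  (Lp.stronglyMeasurable (Φ h)).measurable

theorem field_sum_smul_ae {ι : Type*} (s : Finset ι) (c : ι → ℝ) (h : ι → L) :
    (fun ω => Φ (∑ i ∈ s, c i • h i) ω) =ᵐ[P] fun ω => ∑ i ∈ s, c i * Φ (h i) ω := by
  classical
  induction s using Finset.induction_on with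
  | empty =>
    simp only [Finset.sum_empty, map_zero]
    exact Lp.coeFn_zero ℝ 2 P
  | insert i s hi ih =>
    simp only [Finset.sum_insert hi]
    rw [map_add, map_smul]
    filter_upwards [Lp.coeFn_add (c i • Φ (h i)) (Φ (∑ i ∈ s, c i • h i)),
      Lp.coeFn_smul (c i) (Φ (h i)), ih] with ω h1 h2 h3
    rw [h1, Pi.add_apply, h2, h3, Pi.smul_apply, smul_eq_mul]

theorem IsGaussianField.norm_map (hΦ : IsGaussianField P Φ) (h : L) : ‖Φ h‖ = ‖h‖ := by
  have key : ⟪Φ h, Φ h⟫ = ⟪h, h⟫ := by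
    rw [L2.inner_def, ← hΦ.covariance]
    rfl
  rw [real_inner_self_eq_norm_sq, real_inner_self_eq_norm_sq] at key
  exact (pow_left_inj₀ (norm_nonneg _) (norm_nonneg _) two_ne_zero).1 key

/-- The field as a linear isometry. -/
def IsGaussianField.toLinearIsometry (hΦ : IsGaussianField P Φ) : L →ₗᵢ[ℝ] Lp ℝ 2 P :=
  ⟨Φ, hΦ.norm_map⟩

theorem IsGaussianField.continuous (hΦ : IsGaussianField P Φ) : Continuous Φ :=
  hΦ.toLinearIsometry.continuous

theorem IsGaussianField.map_eq_gaussianReal (hΦ : IsGaussianField P Φ) (h : L) :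
    P.map (fun ω => Φ h ω) = gaussianReal 0 (‖h‖ ^ 2).toNNReal := by
  have hv : Var[fun ω => Φ h ω; P] = ‖h‖ ^ 2 := by
    rw [variance_of_integral_eq_zero (measurable_field h).aemeasurable (hΦ.mean_zero h),
      ← real_inner_self_eq_norm_sq, ← hΦ.covariance]
    exact integral_congr_ae (.of_forall fun ω => pow_two _)
  rw [(hΦ.gaussian.hasGaussianLaw_eval h).map_eq_gaussianReal, hΦ.mean_zero, hv]

/-- Isometric finite families have the same joint law under a Gaussian field. -/
theorem IsGaussianField.map_family_eq [IsProbabilityMeasure P] (hΦ : IsGaussianField P Φ)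
    {ι : Type*} [Fintype ι] (h h' : ι → L)
    (hn : ∀ c : ι → ℝ, ‖∑ i, c i • h i‖ = ‖∑ i, c i • h' i‖) :
    P.map (fun ω i => Φ (h i) ω) = P.map (fun ω i => Φ (h' i) ω) := by
  classical
  have hm : ∀ k : ι → L, Measurable fun ω i => Φ (k i) ω := fun k =>
    measurable_pi_lambda _ fun i => measurable_field (k i)
  have hP : ∀ k : ι → L, IsProbabilityMeasure (P.map fun ω i => Φ (k i) ω) := fun k =>
    Measure.isProbabilityMeasure_map (hm k).aemeasurable
  have := hP h
  have := hP h'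
  refine Measure.ext_of_charFunDual (funext fun ℓ => ?_)
  -- By linearity of `Φ`, a functional `ℓ` of the family is the field at one vector, whose law
  -- depends only on the norm of that vector.
  have key : ∀ k : ι → L, (P.map fun ω i => Φ (k i) ω).map ℓ =
      gaussianReal 0 (‖∑ i, ℓ (Pi.single i 1) • k i‖ ^ 2).toNNReal := by
    intro k
    rw [Measure.map_map ℓ.continuous.measurable (hm k), ← hΦ.map_eq_gaussianReal]
    refine Measure.map_congr ?_
    filter_upwards [field_sum_smul_ae (Φ := Φ) Finset.univ (fun i => ℓ (Pi.single i 1)) k]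
      with ω hω
    rw [hω, Function.comp_apply, ← ContinuousLinearMap.coe_coe, LinearMap.pi_apply_eq_sum_univ]
    refine Finset.sum_congr rfl fun i _ => ?_
    rw [smul_eq_mul, mul_comm]
    congr 2
    ext j
    simp [Pi.single_apply, eq_comm]
  rw [charFunDual_eq_charFun_map_one, charFunDual_eq_charFun_map_one, key, key, hn]

theorem IsGaussianField.map_process_eq [IsProbabilityMeasure P] (hΦ : IsGaussianField P Φ)
    {T : Type*} (h : T → L) (U : L →ₗᵢ[ℝ] L) :
    P.map (fun ω t => Φ (h t) ω) = P.map (fun ω t => Φ (U (h t)) ω) := by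
  have hm : ∀ k : T → L, AEMeasurable (fun ω t => Φ (k t) ω) P := fun k =>
    (measurable_pi_lambda _ fun i => measurable_field (k i)).aemeasurable
  refine (map_eq_iff_forall_finset_map_restrict_eq (hm h) (hm fun t => U (h t))).2 fun I => ?_
  refine hΦ.map_family_eq (fun i : I => h i) (fun i : I => U (h i)) fun c => ?_
  rw [← U.norm_map, map_sum]
  simp only [map_smul]

/-- An orthonormal family is mapped to a standard Gaussian vector. -/
theorem IsGaussianField.map_orthonormal [IsProbabilityMeasure P] (hΦ : IsGaussianField P Φ)
    {ι : Type*} [Fintype ι] (e : ι → L) (he : Orthonormal ℝ e) :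
    P.map (fun ω i => Φ (e i) ω) = Measure.pi fun _ => gaussianReal 0 1 := by
  -- Gaussian processes have Gaussian marginals indexed by finsets; `ℓ` reindexes from `Finset.univ`
  -- to `ι`.
  let ℓ : ((i : (Finset.univ : Finset ι)) → ℝ) →L[ℝ] ι → ℝ :=
    ContinuousLinearMap.pi fun i =>
      ContinuousLinearMap.proj (⟨i, Finset.mem_univ i⟩ : (Finset.univ : Finset ι))
  have hlaw : HasGaussianLaw (fun ω i => Φ (e i) ω) P :=
    ((hΦ.gaussian.comp_right e).hasGaussianLaw Finset.univ).map_fun ℓ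
  have hind : iIndepFun (fun i ω => Φ (e i) ω) P := by
    refine hlaw.iIndepFun_of_covariance_eq_zero fun i j hij => ?_
    rw [covariance_eq_sub (Lp.memLp _) (Lp.memLp _), hΦ.mean_zero, zero_mul, sub_zero]
    exact (hΦ.covariance _ _).trans (he.2 hij)
  rw [(iIndepFun_iff_map_fun_eq_pi_map fun i => (measurable_field (e i)).aemeasurable).1 hind]
  congr 1
  funext i
  rw [hΦ.map_eq_gaussianReal, he.1 i]
  simp

end Law

/-! ### The Malliavin derivative on polynomial variables. -/

section Malliavin

variable {Ω : Type*} [MeasurableSpace Ω] {L : Type*} [NormedAddCommGroup L]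
  [InnerProductSpace ℝ L] {P : Measure Ω} {Φ : L →ₗ[ℝ] Lp ℝ 2 P}

theorem polyGradient_eq_gradAt {n : ℕ} (h : Fin n → L) (p : MvPolynomial (Fin n) ℝ) :
    polyGradient Φ h p = fun ω => gradAt (fun i => Φ (h i) ω) h p := rfl

theorem IsGaussianField.memLp_eval [IsProbabilityMeasure P] (hΦ : IsGaussianField P Φ) {n : ℕ}
    (h : Fin n → L) (p : MvPolynomial (Fin n) ℝ) (q : ℝ≥0∞) (hq : q ≠ ∞) :
    MemLp (fun ω => MvPolynomial.eval (fun i => Φ (h i) ω) p) q P := by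
  induction p using MvPolynomial.induction_on generalizing q with
  | C a => simpa using memLp_const a
  | add p r hp hr =>
    simp only [map_add]
    exact (hp q hq).add (hr q hq)
  | mul_X p i hp =>
    -- Hölder's inequality doubles the exponent for each factor, so the induction runs over all
    -- finite `q`.
    have h2 : 2 * q ≠ ∞ := ENNReal.mul_ne_top (by simp) hq
    have : ENNReal.HolderTriple (2 * q) (2 * q) q := ⟨by
      rw [ENNReal.mul_inv (by simp) (by simp), ← add_mul, ENNReal.inv_two_add_inv_two, one_mul]⟩
    simp only [map_mul, MvPolynomial.eval_X]
    exact ((hΦ.gaussian.hasGaussianLaw_eval (h i)).memLp h2).mul (hp (2 * q) h2)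

theorem IsGaussianField.memLp_polyField [IsProbabilityMeasure P] (hΦ : IsGaussianField P Φ)
    {n : ℕ} (h : Fin n → L) (p : MvPolynomial (Fin n) ℝ) : MemLp (polyField Φ h p) 2 P :=
  hΦ.memLp_eval h p 2 (by simp)

theorem IsGaussianField.memLp_polyGradient [IsProbabilityMeasure P] (hΦ : IsGaussianField P Φ)
    {n : ℕ} (h : Fin n → L) (p : MvPolynomial (Fin n) ℝ) : MemLp (polyGradient Φ h p) 2 P :=
  memLp_finsetSum _ fun j _ =>
    (ContinuousLinearMap.toSpanSingleton ℝ (h j)).comp_memLp'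
      (hΦ.memLp_eval h (MvPolynomial.pderiv j p) 2 (by simp))

/-- A polynomial random variable which vanishes almost surely has vanishing gradient. -/
theorem IsGaussianField.polyGradient_ae_eq_zero [IsProbabilityMeasure P]
    (hΦ : IsGaussianField P Φ) {n : ℕ} (h : Fin n → L) (p : MvPolynomial (Fin n) ℝ)
    (hp : polyField Φ h p =ᵐ[P] 0) : polyGradient Φ h p =ᵐ[P] 0 := by
  let V : Submodule ℝ L := Submodule.span ℝ (Set.range h)
  have : FiniteDimensional ℝ V := FiniteDimensional.span_of_finite ℝ (Set.finite_range h)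
  let b := stdOrthonormalBasis ℝ V
  let e : Fin (Module.finrank ℝ V) → L := fun j => b j
  have he : Orthonormal ℝ e := b.orthonormal.comp_linearIsometry V.subtypeₗᵢ
  let a : Fin n → Fin (Module.finrank ℝ V) → ℝ :=
    fun i => b.repr ⟨h i, Submodule.subset_span ⟨i, rfl⟩⟩
  have ha : ∀ i, ∑ j, a i j • e j = h i := fun i => by
    have := congrArg (V.subtype) (b.sum_repr ⟨h i, Submodule.subset_span ⟨i, rfl⟩⟩)
    simpa using this
  let g : Fin n → MvPolynomial (Fin (Module.finrank ℝ V)) ℝ :=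
    fun i => ∑ j, MvPolynomial.C (a i j) * MvPolynomial.X j
  have hx : ∀ᵐ ω ∂P, ∀ i, MvPolynomial.eval (fun j => Φ (e j) ω) (g i) = Φ (h i) ω := by
    refine ae_all_iff.2 fun i => ?_
    filter_upwards [field_sum_smul_ae (Φ := Φ) Finset.univ (a i) e] with ω hω
    rw [ha] at hω
    simp [g, hω]
  have hq : MvPolynomial.bind₁ g p = 0 := by
    have hpos : (gaussianReal 0 1).IsOpenPosMeasure :=
      (gaussianReal_absolutelyContinuous' 0 one_ne_zero).isOpenPosMeasure
    have hzero : (fun y => MvPolynomial.eval y (MvPolynomial.bind₁ g p))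
        =ᵐ[Measure.pi fun _ => gaussianReal 0 1] fun _ => 0 := by
      rw [← hΦ.map_orthonormal e he]
      refine (ae_map_iff (measurable_pi_lambda _ fun j => measurable_field (e j)).aemeasurable
        (measurableSet_eq_fun (MvPolynomial.continuous_eval _).measurable
          measurable_const)).2 ?_
      filter_upwards [hx, hp] with ω h1 h2
      rw [eval_bind₁_apply, funext h1]
      exact h2
    refine MvPolynomial.funext fun y => ?_
    rw [map_zero]
    exact congrFun ((Continuous.ae_eq_iff_eq _ (MvPolynomial.continuous_eval _)
      continuous_const).1 hzero) y
  filter_upwards [hx] with ω hω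
  have key := gradAt_bind₁ g (fun j => Φ (e j) ω) e p
  have hgrad : (fun i => gradAt (fun j => Φ (e j) ω) e (g i)) = h :=
    funext fun i => (gradAt_linear _ _ _).trans (ha i)
  rw [funext hω, hgrad, hq, ← MvPolynomial.C_0, gradAt_C] at key
  exact key.symm

theorem gradAt_bind₁_X_comp {m n : ℕ} (f : Fin m → Fin n) (x : Fin n → ℝ) (h : Fin n → L)
    (p : MvPolynomial (Fin m) ℝ) :
    gradAt x h (MvPolynomial.bind₁ (fun i => MvPolynomial.X (f i)) p) =
      gradAt (x ∘ f) (h ∘ f) p := by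
  rw [gradAt_bind₁]
  simp only [MvPolynomial.eval_X, gradAt_X]
  rfl

/-- The graph of the Malliavin derivative consists of the pairs given by its formula. -/
theorem mem_malliavinGraph_iff {FG : Lp ℝ 2 P × Lp L 2 P} :
    FG ∈ malliavinGraph Φ ↔ ∃ (n : ℕ) (h : Fin n → L) (p : MvPolynomial (Fin n) ℝ),
      FG.1 =ᵐ[P] polyField Φ h p ∧ FG.2 =ᵐ[P] polyGradient Φ h p := by
  refine ⟨fun hFG => ?_, fun hFG => Submodule.subset_span hFG⟩
  induction hFG using Submodule.span_induction with
  | mem x hx => exact hx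
  | zero =>
    refine ⟨0, 0, 0, ?_, ?_⟩
    · filter_upwards [Lp.coeFn_zero ℝ 2 P] with ω hω
      simpa [polyField] using hω
    · filter_upwards [Lp.coeFn_zero L 2 P] with ω hω
      simpa [polyGradient] using hω
  | add x y _ _ hx hy =>
    obtain ⟨m, h, p, h1, h2⟩ := hx
    obtain ⟨n, k, q, k1, k2⟩ := hy
    -- Concatenating the two families makes both polynomials functions of one set of variables.
    refine ⟨m + n, Fin.append h k,
      MvPolynomial.bind₁ (fun i => MvPolynomial.X (Fin.castAdd n i)) p +
        MvPolynomial.bind₁ (fun i => MvPolynomial.X (Fin.natAdd m i)) q, ?_, ?_⟩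
    · filter_upwards [Lp.coeFn_add x.1 y.1, h1, k1] with ω e1 e2 e3
      rw [Prod.fst_add, e1, Pi.add_apply, e2, e3]
      simp [polyField, eval_bind₁_apply]
    · filter_upwards [Lp.coeFn_add x.2 y.2, h2, k2] with ω e1 e2 e3
      rw [Prod.snd_add, e1, Pi.add_apply, e2, e3]
      simp [polyGradient_eq_gradAt, gradAt_add, gradAt_bind₁_X_comp, Function.comp_def]
  | smul c x _ hx =>
    obtain ⟨m, h, p, h1, h2⟩ := hx
    refine ⟨m, h, MvPolynomial.C c * p, ?_, ?_⟩
    · filter_upwards [Lp.coeFn_smul c x.1, h1] with ω e1 e2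
      rw [Prod.smul_fst, e1, Pi.smul_apply, e2]
      simp [polyField]
    · filter_upwards [Lp.coeFn_smul c x.2, h2] with ω e1 e2
      rw [Prod.smul_snd, e1, Pi.smul_apply, e2]
      simp [polyGradient_eq_gradAt, gradAt_mul, gradAt_C]

/-- This single-valuedness is what makes `Submodule.toLinearPMap` have the prescribed graph. -/
theorem IsGaussianField.snd_eq_zero_of_mem_malliavinGraph [IsProbabilityMeasure P]
    (hΦ : IsGaussianField P Φ) (x : Lp ℝ 2 P × Lp L 2 P) (hx : x ∈ malliavinGraph Φ)
    (hx0 : x.1 = 0) : x.2 = 0 := by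
  obtain ⟨n, h, p, h1, h2⟩ := mem_malliavinGraph_iff.1 hx
  rw [hx0] at h1
  exact (Lp.eq_zero_iff_ae_eq_zero).2
    (h2.trans (hΦ.polyGradient_ae_eq_zero h p (h1.symm.trans (Lp.coeFn_zero ℝ 2 P))))

theorem IsGaussianField.graph_malliavinDerivative [IsProbabilityMeasure P]
    (hΦ : IsGaussianField P Φ) : (malliavinDerivative Φ).graph = malliavinGraph Φ :=
  Submodule.toLinearPMap_graph_eq _ hΦ.snd_eq_zero_of_mem_malliavinGraph

theorem IsGaussianField.mem_domain_iff [IsProbabilityMeasure P] (hΦ : IsGaussianField P Φ)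
    {F : Lp ℝ 2 P} : F ∈ (malliavinDerivative Φ).domain ↔
      ∃ (n : ℕ) (h : Fin n → L) (p : MvPolynomial (Fin n) ℝ), F =ᵐ[P] polyField Φ h p := by
  rw [LinearPMap.mem_domain_iff, hΦ.graph_malliavinDerivative]
  constructor
  · rintro ⟨G, hG⟩
    obtain ⟨n, h, p, h1, -⟩ := mem_malliavinGraph_iff.1 hG
    exact ⟨n, h, p, h1⟩
  · rintro ⟨n, h, p, h1⟩
    exact ⟨(hΦ.memLp_polyGradient h p).toLp, mem_malliavinGraph_iff.2
      ⟨n, h, p, h1, (hΦ.memLp_polyGradient h p).coeFn_toLp⟩⟩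

theorem IsGaussianField.malliavinDerivative_eq_of_mem_graph [IsProbabilityMeasure P]
    (hΦ : IsGaussianField P Φ) (F : (malliavinDerivative Φ).domain) {G : Lp L 2 P}
    (hG : ((F : Lp ℝ 2 P), G) ∈ malliavinGraph Φ) : malliavinDerivative Φ F = G := by
  rw [← hΦ.graph_malliavinDerivative] at hG
  exact LinearPMap.mem_graph_snd_inj _ (LinearPMap.mem_graph _ F) hG rfl

/-! ### Intertwining of the derivative with `U_α`. -/

section Covariance

variable (U : L ≃ₗᵢ[ℝ] L) (α : MeasureAut P)

theorem MeasureAut.field_ae_all (hα : ∀ k : L, Φ (U k) =ᵐ[P] fun ω => Φ k (α.toFun ω)) {n : ℕ}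
    (h : Fin n → L) :
    ∀ᵐ ω ∂P, (fun i => Φ (h i) (α.toFun ω)) = fun i => Φ (U (h i)) ω := by
  filter_upwards [ae_all_iff.2 fun i => hα (h i)] with ω hω
  exact funext fun i => (hω i).symm

theorem MeasureAut.koopman_mem_malliavinGraph
    (hα : ∀ k : L, Φ (U k) =ᵐ[P] fun ω => Φ k (α.toFun ω)) {x : Lp ℝ 2 P × Lp L 2 P}
    (hx : x ∈ malliavinGraph Φ) :
    (α.koopman x.1, α.koopmanTensor U x.2) ∈ malliavinGraph Φ := by
  obtain ⟨n, h, p, h1, h2⟩ := mem_malliavinGraph_iff.1 hx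
  refine mem_malliavinGraph_iff.2 ⟨n, fun i => U (h i), p, ?_, ?_⟩
  · filter_upwards [α.koopman_ae x.1, α.measurePreserving.quasiMeasurePreserving.ae h1,
      α.field_ae_all U hα h] with ω e1 e2 e3
    rw [e1, e2, polyField, e3, polyField]
  · filter_upwards [α.koopmanTensor_ae U x.2, α.measurePreserving.quasiMeasurePreserving.ae h2,
      α.field_ae_all U hα h] with ω e1 e2 e3
    rw [e1, e2, polyGradient, e3, polyGradient, map_sum]
    simp only [map_smul]

theorem IsGaussianField.koopman_mem_domain_iff [IsProbabilityMeasure P]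
    (hΦ : IsGaussianField P Φ) (hα : ∀ k : L, Φ (U k) =ᵐ[P] fun ω => Φ k (α.toFun ω))
    (F : Lp ℝ 2 P) :
    α.koopman F ∈ (malliavinDerivative Φ).domain ↔ F ∈ (malliavinDerivative Φ).domain := by
  rw [hΦ.mem_domain_iff, hΦ.mem_domain_iff]
  constructor
  · rintro ⟨n, h, p, hp⟩
    refine ⟨n, fun i => U.symm (h i), p, ?_⟩
    -- Both sides have the same image under the injective isometry `α.koopman`.
    have hF : F = (hΦ.memLp_polyField (fun i => U.symm (h i)) p).toLp := by
      refine α.koopman.injective (Lp.ext (hp.trans ?_))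
      filter_upwards [α.koopman_ae (hΦ.memLp_polyField (fun i => U.symm (h i)) p).toLp,
        α.measurePreserving.quasiMeasurePreserving.ae
          (hΦ.memLp_polyField (fun i => U.symm (h i)) p).coeFn_toLp,
        α.field_ae_all U hα fun i => U.symm (h i)] with ω e1 e2 e3
      rw [e1, e2, polyField, polyField, e3]
      simp
    rw [hF]
    exact MemLp.coeFn_toLp _
  · rintro ⟨n, h, p, hp⟩
    refine ⟨n, fun i => U (h i), p, ?_⟩
    filter_upwards [α.koopman_ae F, α.measurePreserving.quasiMeasurePreserving.ae hp,
      α.field_ae_all U hα h] with ω e1 e2 e3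
    rw [e1, e2, polyField, e3, polyField]

theorem IsGaussianField.malliavinDerivative_koopman [IsProbabilityMeasure P]
    (hΦ : IsGaussianField P Φ) (hα : ∀ k : L, Φ (U k) =ᵐ[P] fun ω => Φ k (α.toFun ω))
    (F : (malliavinDerivative Φ).domain)
    (hF : α.koopman (F : Lp ℝ 2 P) ∈ (malliavinDerivative Φ).domain) :
    malliavinDerivative Φ ⟨α.koopman (F : Lp ℝ 2 P), hF⟩ =
      α.koopmanTensor U (malliavinDerivative Φ F) := by
  refine hΦ.malliavinDerivative_eq_of_mem_graph _ (α.koopman_mem_malliavinGraph U hα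
    (x := ((F : Lp ℝ 2 P), malliavinDerivative Φ F)) ?_)
  rw [← hΦ.graph_malliavinDerivative]
  exact LinearPMap.mem_graph _ F

end Covariance

end Malliavin

/-! ### Construction and uniqueness of the automorphism. -/

section Automorphism

variable {Ω : Type*} [MeasurableSpace Ω] {P : Measure Ω}

/-- If a measurable map generates the σ-algebra of a standard Borel space up to null sets, then it
has a measurable left inverse up to null sets. -/
theorem exists_measurable_ae_leftInverse [StandardBorelSpace Ω] [Nonempty Ω]
    {E : Type*} [mE : MeasurableSpace E] (X : Ω → E)
    (hX : ∀ A : Set Ω, MeasurableSet A → ∃ B : Set E, MeasurableSet B ∧ A =ᵐ[P] X ⁻¹' B) :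
    ∃ Y : E → Ω, Measurable Y ∧ ∀ᵐ ω ∂P, Y (X ω) = ω := by
  classical
  have hj : MeasurableEmbedding (MeasurableSpace.mapNatBool Ω) :=
    (MeasurableSpace.measurable_mapNatBool Ω).measurableEmbedding
      (MeasurableSpace.injective_mapNatBool Ω)
  have hA : ∀ n, MeasurableSet {ω | MeasurableSpace.mapNatBool Ω ω n = true} := fun n =>
    measurableSet_eq_fun ((measurable_pi_apply n).comp hj.measurable) measurable_const
  choose B hB hAB using fun n => hX _ (hA n)
  -- `Z` reads off the binary code of `ω` from `X ω`, correctly outside a countable union of null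
  -- sets.
  let Z : E → ℕ → Bool := fun x n => decide (x ∈ B n)
  have hZ : Measurable Z := measurable_pi_lambda _ fun n =>
    measurable_to_bool (by simpa [Z, Set.preimage] using hB n)
  refine ⟨hj.invFun ∘ Z, hj.measurable_invFun.comp hZ, ?_⟩
  filter_upwards [ae_all_iff.2 hAB] with ω hω
  have : Z (X ω) = MeasurableSpace.mapNatBool Ω ω := funext fun n => by
    have h1 : (MeasurableSpace.mapNatBool Ω ω n = true) = (X ω ∈ B n) := hω n
    simp [Z, ← h1]
  rw [Function.comp_apply, this, hj.leftInverse_invFun]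

variable {L : Type*} [NormedAddCommGroup L] [InnerProductSpace ℝ L] {Φ : L →ₗ[ℝ] Lp ℝ 2 P}

/-- For a dense sequence `h`, every set of the σ-algebra of the field is, up to a null set,
measurable with respect to the random variables `Φ (h n)`. -/
theorem IsGaussianField.exists_preimage_ae_eq (hΦ : IsGaussianField P Φ) {h : ℕ → L}
    (hd : DenseRange h) {A : Set Ω} (hA : MeasurableSet[fieldSigmaAlgebra Φ] A) :
    ∃ B : Set (ℕ → ℝ), MeasurableSet B ∧ A =ᵐ[P] (fun ω n => Φ (h n) ω) ⁻¹' B := by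
  let X : Ω → ℕ → ℝ := fun ω n => Φ (h n) ω
  suffices hle : fieldSigmaAlgebra Φ ≤
      eventuallyMeasurableSpace (MeasurableSpace.comap X inferInstance) (ae P) by
    obtain ⟨C, ⟨B, hB, rfl⟩, hC⟩ := hle A hA
    exact ⟨B, hB, hC⟩
  refine iSup_le fun k => ?_
  -- `L²` convergence gives almost sure convergence along a subsequence; the limsup is a version of
  -- `Φ k` that is measurable in `X`.
  obtain ⟨u, hu, hlim⟩ := mem_closure_iff_seq_limit.1 (hd k)
  choose a ha using hu
  obtain ⟨ns, -, hns⟩ := (tendstoInMeasure_of_tendsto_Lp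
    ((hΦ.continuous.tendsto k).comp hlim)).exists_seq_tendsto_ae
  let G : (ℕ → ℝ) → ℝ := fun x => Filter.limsup (fun i => x (a (ns i))) Filter.atTop
  have hG : Measurable G := .limsup fun i => measurable_pi_apply (a (ns i))
  have hk : (fun ω => Φ k ω) =ᵐ[P] G ∘ X := by
    filter_upwards [hns] with ω hω
    simp only [Function.comp_apply, ← ha] at hω
    exact hω.limsup_eq.symm
  rintro _ ⟨S, hS, rfl⟩
  rw [← BorelSpace.measurable_eq (α := ℝ)] at hS
  exact ⟨X ⁻¹' (G ⁻¹' S), ⟨G ⁻¹' S, hG hS, rfl⟩, hk.preimage S⟩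

theorem ae_eq_of_field_ae_eq {X : Ω → ℕ → ℝ} {Y : (ℕ → ℝ) → Ω}
    (hYX : ∀ᵐ ω ∂P, Y (X ω) = ω) {β γ : Ω → Ω} (hβ : MeasurePreserving β P P)
    (hγ : MeasurePreserving γ P P) (hX : ∀ n, ∀ᵐ ω ∂P, X (β ω) n = X (γ ω) n) :
    β =ᵐ[P] γ := by
  filter_upwards [hβ.quasiMeasurePreserving.ae hYX, hγ.quasiMeasurePreserving.ae hYX,
    ae_all_iff.2 hX] with ω h1 h2 h3
  rw [← h1, ← h2, funext h3]

/-- Every isometry of `L` is induced by a measure preserving map, given a measurable left inverse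
of the field along a dense sequence. -/
theorem IsGaussianField.exists_measurePreserving [IsProbabilityMeasure P]
    (hΦ : IsGaussianField P Φ) {h : ℕ → L} (hd : DenseRange h) {Y : (ℕ → ℝ) → Ω}
    (hY : Measurable Y) (hYX : ∀ᵐ ω ∂P, Y (fun n => Φ (h n) ω) = ω) (U : L →ₗᵢ[ℝ] L) :
    ∃ α : Ω → Ω, MeasurePreserving α P P ∧ ∀ k, Φ (U k) =ᵐ[P] fun ω => Φ k (α ω) := by
  have hX : Measurable fun ω n => Φ (h n) ω :=
    measurable_pi_lambda _ fun n => measurable_field (h n)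
  have hXU : Measurable fun ω n => Φ (U (h n)) ω :=
    measurable_pi_lambda _ fun n => measurable_field (U (h n))
  have hlaw := hΦ.map_process_eq h U
  have hα : MeasurePreserving (fun ω => Y fun n => Φ (U (h n)) ω) P P := by
    refine ⟨hY.comp hXU, ?_⟩
    have : P.map (Y ∘ fun ω n => Φ (h n) ω) = P := by
      rw [Measure.map_congr (g := id) (f := Y ∘ fun ω n => Φ (h n) ω) hYX, Measure.map_id]
    rwa [← Measure.map_map hY hX, hlaw, Measure.map_map hY hXU] at this
  refine ⟨_, hα, ?_⟩
  -- `Y` is also a right inverse almost everywhere for the law of `X`, hence for the equal law of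
  -- `X_U`.
  have hXY : ∀ᵐ x ∂P.map (fun ω n => Φ (h n) ω), (fun n => Φ (h n) (Y x)) = x := by
    refine (ae_map_iff hX.aemeasurable
      (measurableSet_eq_fun (hX.comp hY) measurable_id)).2 ?_
    filter_upwards [hYX] with ω hω
    exact congrArg (fun ω n => Φ (h n) ω) hω
  rw [hlaw] at hXY
  have hdense : ∀ n, Φ (U (h n)) =
      Lp.compMeasurePreservingₗᵢ ℝ _ hα (Φ (h n)) := fun n => by
    refine Lp.ext ?_
    filter_upwards [ae_of_ae_map hXU.aemeasurable hXY,
      Lp.coeFn_compMeasurePreserving (Φ (h n)) hα] with ω h1 h2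
    exact (congrFun h1 n).symm.trans h2.symm
  have hall : (fun k => Φ (U k)) = fun k => Lp.compMeasurePreservingₗᵢ ℝ _ hα (Φ k) :=
    hd.equalizer (hΦ.continuous.comp U.continuous)
      ((LinearIsometry.continuous _).comp hΦ.continuous) (funext hdense)
  intro k
  rw [congrFun hall k]
  exact Lp.coeFn_compMeasurePreserving (Φ k) hα

/-- Two measure preserving maps which are inverse to each other almost everywhere define an
automorphism. -/
def MeasureAut.ofInverse [StandardBorelSpace Ω] {α β : Ω → Ω} (hα : MeasurePreserving α P P)
    (hβ : MeasurePreserving β P P) (hβα : ∀ᵐ ω ∂P, β (α ω) = ω) (hαβ : ∀ᵐ ω ∂P, α (β ω) = ω) :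
    MeasureAut P where
  toFun := α
  measurePreserving := hα
  exists_conull := by
    refine ⟨{ω | β (α ω) = ω},
      measurableSet_eq_fun (hβ.measurable.comp hα.measurable) measurable_id, hβα, ?_, ?_⟩
    · change ∀ᵐ ω ∂P, ω ∈ α '' {ω | β (α ω) = ω}
      filter_upwards [hαβ] with ω hω
      exact ⟨β ω, congrArg β hω, hω⟩
    · intro A hA
      refine ⟨β ⁻¹' A, hβ.measurable hA, ?_⟩
      ext ω
      refine and_congr_left fun hω => ?_
      change ω ∈ A ↔ β (α ω) ∈ A
      rw [show β (α ω) = ω from hω]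

/-- A standard Borel σ-algebra is countably generated, so `L²` is second countable, and this passes
to `L` through the isometry. -/
theorem IsGaussianField.exists_denseRange [StandardBorelSpace Ω] [IsProbabilityMeasure P]
    (hΦ : IsGaussianField P Φ) : ∃ h : ℕ → L, DenseRange h := by
  have : Fact ((2 : ℝ≥0∞) ≠ ∞) := ⟨by simp⟩
  have : SecondCountableTopology L :=
    hΦ.toLinearIsometry.isometry.isEmbedding.secondCountableTopology
  exact TopologicalSpace.exists_dense_seq L

theorem IsGaussianField.exists_unique_measureAut [StandardBorelSpace Ω] [IsProbabilityMeasure P]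
    (hΦ : IsGaussianField P Φ) (hgen : GeneratesSigmaAlgebra Φ) (U : L ≃ₗᵢ[ℝ] L) :
    ∃ α : MeasureAut P, (∀ k : L, Φ (U k) =ᵐ[P] fun ω => Φ k (α.toFun ω)) ∧
      ∀ β : MeasureAut P, (∀ k : L, Φ (U k) =ᵐ[P] fun ω => Φ k (β.toFun ω)) →
        β.toFun =ᵐ[P] α.toFun := by
  have : Nonempty Ω := P.nonempty_of_neZero
  obtain ⟨h, hd⟩ := hΦ.exists_denseRange
  obtain ⟨Y, hY, hYX⟩ := exists_measurable_ae_leftInverse (P := P) (fun ω n => Φ (h n) ω)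
    fun A hA => by
      obtain ⟨C, hC, hAC⟩ := hgen A hA
      obtain ⟨B, hB, hCB⟩ := hΦ.exists_preimage_ae_eq hd hC
      exact ⟨B, hB, hAC.trans hCB⟩
  obtain ⟨α, hα, hαU⟩ := hΦ.exists_measurePreserving hd hY hYX U.toLinearIsometry
  obtain ⟨β, hβ, hβU⟩ := hΦ.exists_measurePreserving hd hY hYX U.symm.toLinearIsometry
  -- `β ∘ α` induces `U ∘ U⁻¹` on the field, as the identity map does.
  have hβα : β ∘ α =ᵐ[P] id := by
    refine ae_eq_of_field_ae_eq hYX (hβ.comp hα) (.id P) fun n => ?_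
    filter_upwards [hα.quasiMeasurePreserving.ae (hβU (h n)), hαU (U.symm (h n))] with ω h1 h2
    simpa using h1.symm.trans h2.symm
  have hαβ : α ∘ β =ᵐ[P] id := by
    refine ae_eq_of_field_ae_eq hYX (hα.comp hβ) (.id P) fun n => ?_
    filter_upwards [hβ.quasiMeasurePreserving.ae (hαU (h n)), hβU (U (h n))] with ω h1 h2
    simpa using h1.symm.trans h2.symm
  refine ⟨.ofInverse hα hβ hβα hαβ, hαU, fun γ hγ => ?_⟩
  exact ae_eq_of_field_ae_eq hYX γ.measurePreserving hα fun n =>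
    (hγ (h n)).symm.trans (hαU (h n))

end Automorphism

end GaussianField

end

theorem mainTheorem8
    {Ω : Type*} [MeasurableSpace Ω] [StandardBorelSpace Ω] (P : Measure Ω) [IsProbabilityMeasure P]
    {L : Type*} [NormedAddCommGroup L] [InnerProductSpace ℝ L] [CompleteSpace L]
    (Φ : L →ₗ[ℝ] Lp ℝ 2 P) (hΦ : GaussianField.IsGaussianField P Φ)
    (hgen : GaussianField.GeneratesSigmaAlgebra Φ) :
    -- The Malliavin derivative is well defined by its formula on the polynomial domain.
    ((∀ (n : ℕ) (h : Fin n → L) (p : MvPolynomial (Fin n) ℝ),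
        ∃ F : (GaussianField.malliavinDerivative Φ).domain,
          (F : Lp ℝ 2 P) =ᵐ[P] GaussianField.polyField Φ h p ∧
          GaussianField.malliavinDerivative Φ F =ᵐ[P] GaussianField.polyGradient Φ h p) ∧
      (∀ F : (GaussianField.malliavinDerivative Φ).domain,
        ∃ (n : ℕ) (h : Fin n → L) (p : MvPolynomial (Fin n) ℝ),
          (F : Lp ℝ 2 P) =ᵐ[P] GaussianField.polyField Φ h p)) ∧
    -- (1) Existence and uniqueness of the automorphism.
    (∀ U : L ≃ₗᵢ[ℝ] L,
      ∃ α : GaussianField.MeasureAut P,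
        (∀ k : L, Φ (U k) =ᵐ[P] fun ω => Φ k (α.toFun ω)) ∧
        (∀ k : L, Φ (U k) = α.koopman (Φ k)) ∧
        ∀ β : GaussianField.MeasureAut P,
          (∀ k : L, Φ (U k) =ᵐ[P] fun ω => Φ k (β.toFun ω)) → β.toFun =ᵐ[P] α.toFun) ∧
    -- (2) Covariance `T U_α = (U_α ⊗ U) T`, including equality of the domains.
    (∀ (U : L ≃ₗᵢ[ℝ] L) (α : GaussianField.MeasureAut P),
      (∀ k : L, Φ (U k) =ᵐ[P] fun ω => Φ k (α.toFun ω)) →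
      (∀ F : Lp ℝ 2 P, α.koopman F ∈ (GaussianField.malliavinDerivative Φ).domain ↔
        F ∈ (GaussianField.malliavinDerivative Φ).domain) ∧
      ∀ (F : (GaussianField.malliavinDerivative Φ).domain)
        (hF : α.koopman (F : Lp ℝ 2 P) ∈ (GaussianField.malliavinDerivative Φ).domain),
        GaussianField.malliavinDerivative Φ ⟨α.koopman (F : Lp ℝ 2 P), hF⟩ =
          α.koopmanTensor U (GaussianField.malliavinDerivative Φ F)) := by
  refine ⟨⟨fun n h p => ?_, fun F => hΦ.mem_domain_iff.1 F.2⟩, fun U => ?_, fun U α hα =>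
    ⟨hΦ.koopman_mem_domain_iff U α hα, hΦ.malliavinDerivative_koopman U α hα⟩⟩
  · have h1 := (hΦ.memLp_polyField h p).coeFn_toLp
    have h2 := (hΦ.memLp_polyGradient h p).coeFn_toLp
    refine ⟨⟨_, hΦ.mem_domain_iff.2 ⟨n, h, p, h1⟩⟩, h1, ?_⟩
    rw [hΦ.malliavinDerivative_eq_of_mem_graph _
      (GaussianField.mem_malliavinGraph_iff.2 ⟨n, h, p, h1, h2⟩)]
    exact h2
  · obtain ⟨α, hα, huniq⟩ := hΦ.exists_unique_measureAut hgen U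
    exact ⟨α, hα, fun k => Lp.ext ((hα k).trans (α.koopman_ae (Φ k)).symm), huniq⟩
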